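/- Let $\Bbbk$ be a field, $R = \Bbbk[x_0, \ldots, x_n]$, and let $I \subsetneq R$ be a nonzero proper monomial ideal. Let $\operatorname{Ass}(I)$ be the set of associated primes of $I$ and let $\operatorname{maxAss}(I)$ be the set of those that are maximal in $\operatorname{Ass}(I)$ with respect to inclusion. For $m \ge 0$, the $m$-th symbolic power of $I$ is $$I^{(m)} = \bigcap_{P \in \operatorname{Ass}(I)} \left(R \cap I^m R_P\right).$$ For a nonzero homogeneous ideal $J$, let $\alpha(J)$ be the least degree $d$ with $J_d \neq 0$. The Waldschmidt constant of $I$ is $\gamma(I) = \lim_{m \to \infty} \alpha(I^{(m)})/m$. For $P \in \operatorname{maxAss}(I)$ put $Q_{\subseteq P} = R \cap I R_P$. For a monomial ideal $J$, let $\mathcal{L}(J) \subseteq \mathbb{N}^{n+1} \subseteq \mathbb{R}^{n+1}$ be the set of exponent vectors of the monomials in $J$. The symbolic polyhedron of $I$ is $$\mathcal{Q} = \bigcap_{P \in \operatorname{maxAss}(I)} \operatorname{conv}\left(\mathcal{L}(Q_{\subseteq P})\right) \subseteq \mathbb{R}^{n+1}.$$ Then the coordinate sum $a_0 + \cdots +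 a_n$ attains a minimum on $\mathcal{Q}$, the limit defining $\gamma(I)$ exists, and $$\alpha(\mathcal{Q}) := \min\{a_0 + \cdots + a_n \mid (a_0, \ldots, a_n) \in \mathcal{Q}\} = \gamma(I).$$ -/

import Mathlib

open Filter Topology

noncomputable section

namespace SymbolicPolyhedron

section CommRing

variable {R : Type*} [CommRing R]

/-- The set of associated primes of an ideal `I`, i.e. the associated primes of the
`R`-module `R ⧸ I`. -/
def ass (I : Ideal R) : Set (Ideal R) := associatedPrimes R (R ⧸ I)

theorem isPrime_of_mem_ass {I P : Ideal R} (hP : P ∈ ass I) : P.IsPrime :=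
  IsAssociatedPrime.isPrime hP

/-- The associated primes of `I` that are maximal with respect to inclusion
among the associated primes of `I`. -/
def maxAss (I : Ideal R) : Set (Ideal R) := {P | Maximal (· ∈ ass I) P}

theorem isPrime_of_mem_maxAss {I P : Ideal R} (hP : P ∈ maxAss I) : P.IsPrime :=
  isPrime_of_mem_ass hP.prop

/-- The contraction `R ∩ J R_P` of the extension of `J` to the localization `R_P`. -/
def localContraction (J P : Ideal R) (hP : P.IsPrime) : Ideal R :=
  (J.map (algebraMap R (Localization.AtPrime P))).comap
    (algebraMap R (Localization.AtPrime P))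

/-- The `m`-th symbolic power `I^(m) = R ∩ ⋂_{P ∈ Ass(I)} I^m R_P`. -/
def symbolicPower (I : Ideal R) (m : ℕ) : Ideal R :=
  ⨅ (P : Ideal R) (hP : P ∈ ass I), localContraction (I ^ m) P (isPrime_of_mem_ass hP)

end CommRing

section MvPolynomial

variable {σ k : Type*} [Field k]

/-- A monomial ideal is an ideal generated by a set of monomials. -/
def IsMonomialIdeal (I : Ideal (MvPolynomial σ k)) : Prop :=
  ∃ S : Set (σ →₀ ℕ), I = Ideal.span ((fun a => MvPolynomial.monomial a (1 : k)) '' S)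

/-- `α(I)`: the least degree `d` with `I_d ≠ 0`, where `I_d` is the set of forms
of degree `d` in `I`. -/
def initialDegree (I : Ideal (MvPolynomial σ k)) : ℕ :=
  sInf {d : ℕ | ∃ f ∈ I, f ≠ 0 ∧ f.IsHomogeneous d}

/-- The Waldschmidt constant `γ(I) = lim_{m → ∞} α(I^(m)) / m`. -/
def waldschmidtConstant (I : Ideal (MvPolynomial σ k)) : ℝ :=
  limUnder atTop (fun m : ℕ => (initialDegree (symbolicPower I m) : ℝ) / (m : ℝ))

/-- The exponent vectors, as points of real space, of the monomials in `I`. -/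
def latticePoints (I : Ideal (MvPolynomial σ k)) : Set (σ → ℝ) :=
  {v | ∃ a : σ →₀ ℕ, MvPolynomial.monomial a (1 : k) ∈ I ∧ v = fun i => (a i : ℝ)}

/-- The symbolic polyhedron of `I`: the intersection over the maximal associated primes `P`
of the convex hulls of the exponent vectors of the monomials in `R ∩ I R_P`. -/
def symbolicPolyhedron (I : Ideal (MvPolynomial σ k)) : Set (σ → ℝ) :=
  ⋂ (P : Ideal (MvPolynomial σ k)) (hP : P ∈ maxAss I),
    convexHull ℝ (latticePoints (localContraction I P (isPrime_of_mem_maxAss hP)))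

end MvPolynomial

/-- The set of coordinate sums `a₁ + ⋯ + a_N` of the points of a set in real space. -/
def coordinateSums {σ : Type*} [Fintype σ] (Q : Set (σ → ℝ)) : Set ℝ :=
  (fun a : σ → ℝ => ∑ i, a i) '' Q

/-- `α(Q)`: the minimum coordinate sum over `Q` (the infimum, which is the minimum when
it is attained). -/
def minCoordinateSum {σ : Type*} [Fintype σ] (Q : Set (σ → ℝ)) : ℝ :=
  sInf (coordinateSums Q)

end SymbolicPolyhedron

end

/-!
The quotients `α(I^(m)) / m` are squeezed between the least coordinate sum of the symbolic
polyhedron and that number plus `C / m`; neither subadditivity of `m ↦ α(I^(m))` nor rationality of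
the polyhedron is used.

Write `I_P` for the contraction of the localization of `I` at `P`. The contraction of a monomial
ideal at a prime `P` consists of the `f` with `s * f` in the ideal for some `s ∉ P`. Comparing the
minimal terms of `s` and `f`, in an order that looks first at the degree in the variables belonging
to `P`, shows that the contraction contains every monomial of `f`
(`IsMonomialIdeal.localContraction_monomial_mem`). So initial degrees of symbolic powers are degrees
of monomials.

For the lower bound, a monomial in the contraction of `I ^ m` at `P` is divisible by a product of
`m` monomials of `I_P` (`IsMonomialIdeal.exists_sum_le`). Since the convex hull of the exponents of
`I_P` is closed under increasing coordinates, it contains the exponent divided by `m`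
(`IsMonomialIdeal.div_mem_convexHull`).

For the upper bound, a point `v` of the polyhedron is, for each `P`, a convex combination
`∑ w j • c j` of exponents of `I_P`. Rounding up, `∑ ⌈m * w j⌉₊ • c j` is an exponent of
`I_P ^ m`, and it exceeds `m • v` by at most `∑ c j`
(`exists_forall_monomial_mem_localContraction_pow`). The maximal associated primes being finite in
number, one lattice point at bounded distance from `m • v` serves them all.

The minimum is attained because the polyhedron is closed: by Dickson's lemma each of the convex
hulls is a polytope plus the nonnegative orthant (`exists_finite_convexHull_latticePoints`).
-/

namespace SymbolicPolyhedron

open MvPolynomial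
open scoped Pointwise

/-! ### Contractions of localized ideals -/

theorem mem_localContraction {R : Type*} [CommRing R] {J P : Ideal R} {hP : P.IsPrime} {f : R} :
    f ∈ localContraction J P hP ↔ ∃ s ∉ P, s * f ∈ J := by
  rw [localContraction, Ideal.mem_comap,
    IsLocalization.algebraMap_mem_map_algebraMap_iff P.primeCompl]
  rfl

theorem le_localContraction {R : Type*} [CommRing R] {J P : Ideal R} {hP : P.IsPrime} :
    J ≤ localContraction J P hP :=
  Ideal.le_comap_map

theorem localContraction_anti {R : Type*} [CommRing R] {J P P' : Ideal R} {hP : P.IsPrime}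
    {hP' : P'.IsPrime} (h : P ≤ P') : localContraction J P' hP' ≤ localContraction J P hP := by
  intro f hf
  obtain ⟨s, hs, hsf⟩ := mem_localContraction.1 hf
  exact mem_localContraction.2 ⟨s, fun hs' => hs (h hs'), hsf⟩

theorem localContraction_pow_le {R : Type*} [CommRing R] {J P : Ideal R} {hP : P.IsPrime} (m : ℕ) :
    localContraction J P hP ^ m ≤ localContraction (J ^ m) P hP := by
  rw [localContraction, localContraction, Ideal.map_pow]
  exact Ideal.le_comap_pow _ m

/-- Over a Noetherian ring the maximal associated primes suffice to define a symbolic power. -/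
theorem mem_symbolicPower_iff_maxAss {R : Type*} [CommRing R] [IsNoetherianRing R] {I : Ideal R}
    {m : ℕ} {f : R} :
    f ∈ symbolicPower I m ↔ ∀ (P : Ideal R) (hP : P ∈ maxAss I),
      f ∈ localContraction (I ^ m) P (isPrime_of_mem_maxAss hP) := by
  simp only [symbolicPower, Submodule.mem_iInf]
  refine ⟨fun h P hP => h P hP.prop, fun h P hP => ?_⟩
  obtain ⟨P', hPP', hP'⟩ := exists_maximal_ge_of_wellFoundedGT (· ∈ ass I) P hP
  exact localContraction_anti hPP' (h P' hP')

theorem finite_maxAss {R : Type*} [CommRing R] [IsNoetherianRing R] (I : Ideal R) :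
    (maxAss I).Finite :=
  (associatedPrimes.finite R (R ⧸ I)).subset fun _ hP => hP.prop

theorem maxAss_nonempty {R : Type*} [CommRing R] [IsNoetherianRing R] {I : Ideal R} (hI : I ≠ ⊤) :
    (maxAss I).Nonempty := by
  have : Nontrivial (R ⧸ I) := Ideal.Quotient.nontrivial_iff.2 hI
  obtain ⟨P, hP⟩ := associatedPrimes.nonempty R (R ⧸ I)
  obtain ⟨P', -, hP'⟩ := exists_maximal_ge_of_wellFoundedGT (· ∈ ass I) P hP
  exact ⟨P', hP'⟩

/-! ### Monomial ideals -/

variable {σ k : Type*} [Field k]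

theorem IsMonomialIdeal.monomial_mem {J : Ideal (MvPolynomial σ k)} (hJ : IsMonomialIdeal J)
    {f : MvPolynomial σ k} (hf : f ∈ J) {a : σ →₀ ℕ} (ha : a ∈ f.support) :
    monomial a (1 : k) ∈ J := by
  obtain ⟨S, rfl⟩ := hJ
  obtain ⟨b, hb, hba⟩ := mem_ideal_span_monomial_image.1 hf a ha
  refine mem_ideal_span_monomial_image.2 fun c hc => ⟨b, hb, ?_⟩
  rwa [Finset.mem_singleton.1 (support_monomial_subset hc)]

theorem mem_of_monomial_mem {J : Ideal (MvPolynomial σ k)} {f : MvPolynomial σ k}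
    (h : ∀ a ∈ f.support, monomial a (1 : k) ∈ J) : f ∈ J := by
  rw [← f.support_sum_monomial_coeff]
  refine Ideal.sum_mem _ fun a ha => ?_
  simpa [C_mul_monomial] using J.mul_mem_left (C (coeff a f)) (h a ha)

theorem exists_monomial_notMem {P : Ideal (MvPolynomial σ k)} {s : MvPolynomial σ k}
    (hs : s ∉ P) : ∃ b ∈ s.support, monomial b (1 : k) ∉ P := by
  by_contra! h
  exact hs (mem_of_monomial_mem h)

theorem monomial_mem_of_le {J : Ideal (MvPolynomial σ k)} {a b : σ →₀ ℕ} (hab : a ≤ b)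
    (ha : monomial a (1 : k) ∈ J) : monomial b (1 : k) ∈ J := by
  obtain ⟨c, rfl⟩ := exists_add_of_le hab
  simpa [monomial_mul, add_comm] using J.mul_mem_left (monomial c (1 : k)) ha

theorem monomial_notMem_iff {P : Ideal (MvPolynomial σ k)} (hP : P.IsPrime) {b : σ →₀ ℕ} :
    monomial b (1 : k) ∉ P ↔ ∀ i, X i ∈ P → b i = 0 := by
  rw [monomial_eq, C_1, one_mul, Finsupp.prod, hP.prod_mem_iff]
  constructor
  · intro h i hi
    by_contra hb
    exact h ⟨i, Finsupp.mem_support_iff.2 hb, Ideal.pow_mem_of_mem _ hi _ (Nat.pos_of_ne_zero hb)⟩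
  · rintro h ⟨i, hi, hmem⟩
    exact Finsupp.mem_support_iff.1 hi (h i (hP.mem_of_pow_mem _ hmem))

/-- The monomials in the contraction of a monomial ideal: a monomial denominator suffices. -/
theorem IsMonomialIdeal.monomial_mem_localContraction {J P : Ideal (MvPolynomial σ k)}
    (hJ : IsMonomialIdeal J) {hP : P.IsPrime} {a : σ →₀ ℕ} :
    monomial a (1 : k) ∈ localContraction J P hP ↔
      ∃ b : σ →₀ ℕ, monomial b (1 : k) ∉ P ∧ monomial (b + a) (1 : k) ∈ J := by
  rw [mem_localContraction]
  constructor
  · rintro ⟨s, hs, hsJ⟩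
    obtain ⟨b, hb, hbP⟩ := exists_monomial_notMem hs
    refine ⟨b, hbP, hJ.monomial_mem hsJ ?_⟩
    rw [mem_support_iff, coeff_mul_monomial, mul_one]
    exact mem_support_iff.1 hb
  · rintro ⟨b, hbP, hbJ⟩
    exact ⟨_, hbP, by simpa [monomial_mul] using hbJ⟩

/-- Minimal terms multiply: in the order on exponents pulled back along an injective additive map
to an ordered monoid, the product of the minimal terms cannot be cancelled. -/
theorem coeff_mul_of_minimal {Γ : Type*} [AddCommMonoid Γ] [LinearOrder Γ]
    [IsOrderedCancelAddMonoid Γ] (φ : (σ →₀ ℕ) →+ Γ) (hφ : Function.Injective φ)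
    {s f : MvPolynomial σ k} {b a : σ →₀ ℕ} (hb : ∀ b' ∈ s.support, φ b ≤ φ b')
    (ha : ∀ a' ∈ f.support, φ a ≤ φ a') :
    coeff (b + a) (s * f) = coeff b s * coeff a f := by
  classical
  rw [coeff_mul]
  refine Finset.sum_eq_single (b, a) ?_ fun h => absurd (by simp) h
  rintro ⟨b', a'⟩ hmem hne
  by_contra hprod
  have hb' := hb b' (mem_support_iff.2 (left_ne_zero_of_mul hprod))
  have ha' := ha a' (mem_support_iff.2 (right_ne_zero_of_mul hprod))
  have hsum : φ b' + φ a' = φ b + φ a := by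
    rw [← map_add, ← map_add, Finset.HasAntidiagonal.mem_antidiagonal.1 hmem]
  have hbb : φ b' = φ b := by
    refine le_antisymm (not_lt.1 fun hlt => ?_) hb'
    exact (add_lt_add_of_lt_of_le hlt ha').ne hsum.symm
  have haa : φ a' = φ a := by
    rw [hbb] at hsum
    exact add_left_cancel hsum
  exact hne (Prod.ext (hφ hbb) (hφ haa))

/-- The exponent vectors with their weight along `A` put in front, so that in the lexicographic
order monomials of lower degree in the variables of `A` come first. -/
noncomputable def weightLex [LinearOrder σ] (A : Set σ) : (σ →₀ ℕ) →+ ℕ ×ₗ Lex (σ →₀ ℕ) := by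
  classical
  exact
  { toFun := fun a => toLex ((a.filter (· ∈ A)).degree, toLex a)
    map_zero' := by simp; rfl
    map_add' := fun a b => by simp [Finsupp.filter_add]; rfl }

theorem weightLex_injective [LinearOrder σ] (A : Set σ) :
    Function.Injective (weightLex A) := by
  intro a b h
  exact toLex.injective (Prod.ext_iff.1 (toLex.injective h)).2

/-- The contraction of a monomial ideal at any prime is closed under passing to the monomials of its
elements. The prime need not be a monomial ideal, so it is not necessary to know that associated
primes of monomial ideals are generated by variables. -/
theorem IsMonomialIdeal.localContraction_monomial_mem {J P : Ideal (MvPolynomial σ k)}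
    (hJ : IsMonomialIdeal J) {hP : P.IsPrime} {f : MvPolynomial σ k}
    (hf : f ∈ localContraction J P hP) {a : σ →₀ ℕ} (ha : a ∈ f.support) :
    monomial a (1 : k) ∈ localContraction J P hP := by
  classical
  let _ : LinearOrder σ := linearOrderOfSTO WellOrderingRel
  set K := localContraction J P hP
  by_contra haK
  -- Discard the monomials of `f` that lie in the contraction.
  set g : MvPolynomial σ k :=
    ∑ c ∈ f.support.filter (fun c => monomial c (1 : k) ∉ K), monomial c (coeff c f) with hg
  have hgc : ∀ c, coeff c g = if monomial c (1 : k) ∉ K then coeff c f else 0 := by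
    intro c
    rw [hg, coeff_sum]
    simp only [coeff_monomial, Finset.sum_ite_eq', Finset.mem_filter, mem_support_iff]
    by_cases h0 : coeff c f = 0 <;> simp [h0]
  have hgsupp : ∀ c ∈ g.support, monomial c (1 : k) ∉ K := by
    intro c hc hcK
    rw [mem_support_iff, hgc] at hc
    simp [hcK] at hc
  have hgK : g ∈ K := by
    have hfg : f - g ∈ K := mem_of_monomial_mem fun c hc => by
      by_contra hcK
      rw [mem_support_iff, coeff_sub, hgc] at hc
      simp [hcK] at hc
    simpa using K.sub_mem hf hfg
  have hg0 : g.support.Nonempty := by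
    refine ⟨a, ?_⟩
    rw [mem_support_iff, hgc, if_pos haK]
    exact mem_support_iff.1 ha
  obtain ⟨s, hs, hsg⟩ := mem_localContraction.1 hgK
  obtain ⟨b₁, hb₁, hb₁P⟩ := exists_monomial_notMem hs
  let φ := weightLex {i | (X i : MvPolynomial σ k) ∈ P}
  obtain ⟨b₀, hb₀, hbmin⟩ := s.support.exists_min_image φ ⟨b₁, hb₁⟩
  obtain ⟨a₀, ha₀, hamin⟩ := g.support.exists_min_image φ hg0
  -- `s` has a monomial of weight zero, so its minimal monomial has weight zero as well.
  have hb₀P : monomial b₀ (1 : k) ∉ P := by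
    have hle : (b₀.filter (· ∈ {i | (X i : MvPolynomial σ k) ∈ P})).degree ≤
        (b₁.filter (· ∈ {i | (X i : MvPolynomial σ k) ∈ P})).degree :=
      (Prod.Lex.le_iff'.1 (hbmin b₁ hb₁)).1
    have h1 : b₁.filter (· ∈ {i | (X i : MvPolynomial σ k) ∈ P}) = 0 := by
      rw [Finsupp.filter_eq_zero_iff]
      exact (monomial_notMem_iff hP).1 hb₁P
    rw [h1, map_zero, Nat.le_zero, Finsupp.degree_eq_zero_iff, Finsupp.filter_eq_zero_iff] at hle
    exact (monomial_notMem_iff hP).2 hle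
  refine hgsupp a₀ ha₀ (hJ.monomial_mem_localContraction.2 ⟨b₀, hb₀P, hJ.monomial_mem hsg ?_⟩)
  rw [mem_support_iff, coeff_mul_of_minimal φ (weightLex_injective _) hbmin hamin]
  exact mul_ne_zero (mem_support_iff.1 hb₀) (mem_support_iff.1 ha₀)

theorem span_monomial_pow (S : Set (σ →₀ ℕ)) (m : ℕ) :
    Ideal.span ((fun a => monomial a (1 : k)) '' S) ^ m =
      Ideal.span ((fun a => monomial a (1 : k)) '' {a | ∃ c : Fin m → σ →₀ ℕ,
        (∀ j, c j ∈ S) ∧ ∑ j, c j = a}) := by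
  have h := Submodule.span_pow (R := MvPolynomial σ k)
    ((fun a => monomial a (1 : k)) '' S) m
  refine h.trans (congrArg _ ?_)
  ext f
  simp only [Set.mem_pow, Set.mem_image, Set.mem_ofPred_eq, List.prod_ofFn]
  constructor
  · rintro ⟨g, rfl⟩
    choose c hc hcg using fun j => (g j).2
    refine ⟨_, ⟨c, hc, rfl⟩, ?_⟩
    rw [monomial_sum_one]
    exact Finset.prod_congr rfl fun j _ => hcg j
  · rintro ⟨_, ⟨c, hc, rfl⟩, rfl⟩
    exact ⟨fun j => ⟨_, c j, hc j, rfl⟩, (monomial_sum_one _ _).symm⟩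

theorem IsMonomialIdeal.pow {I : Ideal (MvPolynomial σ k)} (hI : IsMonomialIdeal I) (m : ℕ) :
    IsMonomialIdeal (I ^ m) := by
  obtain ⟨S, rfl⟩ := hI
  exact ⟨_, span_monomial_pow S m⟩

/-- A monomial in the contraction of `I ^ m` is divisible by a product of `m` monomials in the
contraction of `I`: set to one, in `m` monomials of `I`, the variables outside the prime. -/
theorem IsMonomialIdeal.exists_sum_le {I P : Ideal (MvPolynomial σ k)}
    (hI : IsMonomialIdeal I) {hP : P.IsPrime} {m : ℕ} {a : σ →₀ ℕ}
    (ha : monomial a (1 : k) ∈ localContraction (I ^ m) P hP) :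
    ∃ c : Fin m → σ →₀ ℕ, (∀ j, monomial (c j) (1 : k) ∈ localContraction I P hP) ∧
      ∑ j, c j ≤ a := by
  classical
  obtain ⟨b, hbP, hb⟩ := (hI.pow m).monomial_mem_localContraction.1 ha
  obtain ⟨S, rfl⟩ := hI
  rw [span_monomial_pow, mem_ideal_span_monomial_image] at hb
  obtain ⟨_, ⟨c, hc, rfl⟩, hle⟩ := hb (b + a) (by simp)
  refine ⟨fun j => (c j).filter fun i => (X i : MvPolynomial σ k) ∈ P, fun j => ?_, ?_⟩
  · refine IsMonomialIdeal.monomial_mem_localContraction ⟨S, rfl⟩ |>.2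
      ⟨(c j).filter fun i => ¬ (X i : MvPolynomial σ k) ∈ P, ?_, ?_⟩
    · rw [monomial_notMem_iff hP]
      intro i hi
      simp [hi]
    · rw [add_comm, Finsupp.filter_add_filter_not]
      exact Ideal.subset_span ⟨_, hc j, rfl⟩
  · intro i
    by_cases hi : (X i : MvPolynomial σ k) ∈ P
    · have hbi := (monomial_notMem_iff hP).1 hbP i hi
      have := hle i
      simp only [Finsupp.add_apply, hbi, zero_add, Finsupp.finsetSum_apply] at this
      simpa [Finsupp.finsetSum_apply, hi] using this
    · simp [Finsupp.finsetSum_apply, hi]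

/-! ### Convex hulls of sets of exponent vectors -/

theorem convexHull_range_natCast : convexHull ℝ (Set.range ((↑) : ℕ → ℝ)) = Set.Ici 0 := by
  refine Set.Subset.antisymm
    (convexHull_min (Set.range_subset_iff.2 fun n => by simp) (convex_Ici 0)) ?_
  intro x hx
  refine (convex_convexHull ℝ (Set.range ((↑) : ℕ → ℝ))).ordConnected.out
    (subset_convexHull ℝ _ ⟨⌊x⌋₊, rfl⟩) (subset_convexHull ℝ _ ⟨⌊x⌋₊ + 1, rfl⟩)
    ⟨Nat.floor_le hx, ?_⟩
  push_cast
  exact (Nat.lt_floor_add_one x).le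

theorem convexHull_natCast_vectors [Finite σ] :
    convexHull ℝ (Set.range fun a : σ →₀ ℕ => fun i => (a i : ℝ)) = Set.Ici 0 := by
  have h : (Set.range fun a : σ →₀ ℕ => fun i => (a i : ℝ)) =
      Set.univ.pi fun _ => Set.range ((↑) : ℕ → ℝ) := by
    ext v
    simp only [Set.mem_range, Set.mem_univ_pi]
    constructor
    · rintro ⟨a, rfl⟩ i
      exact ⟨a i, rfl⟩
    · intro h
      choose c hc using h
      exact ⟨Finsupp.equivFunOnFinite.symm c, funext hc⟩
  rw [h, convexHull_pi, convexHull_range_natCast, ← Set.pi_univ_Ici]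
  rfl

/-- The convex hull of the exponent set of an ideal is a polytope plus the nonnegative orthant;
finiteness of the set of vertices is Dickson's lemma. -/
theorem exists_finite_convexHull_latticePoints [Finite σ] (J : Ideal (MvPolynomial σ k)) :
    ∃ F : Set (σ → ℝ), F.Finite ∧
      convexHull ℝ (latticePoints J) = convexHull ℝ F + Set.Ici (0 : σ → ℝ) := by
  have hfin : {a : σ →₀ ℕ | Minimal (fun b => monomial b (1 : k) ∈ J) a}.Finite :=
    WellQuasiOrderedLE.finite_of_isAntichain (setOfPred_minimal_antichain _)
  refine ⟨_, hfin.image fun a i => (a i : ℝ), ?_⟩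
  rw [← convexHull_natCast_vectors, ← convexHull_add]
  congr 1
  ext v
  simp only [latticePoints, Set.mem_ofPred_eq, Set.mem_add, Set.exists_mem_image,
    Set.exists_range_iff]
  constructor
  · rintro ⟨a, ha, rfl⟩
    obtain ⟨b, hba, hb⟩ := exists_minimal_le_of_wellFoundedLT
      (fun b => monomial b (1 : k) ∈ J) a ha
    obtain ⟨c, rfl⟩ := exists_add_of_le hba
    exact ⟨b, hb, c, by ext; simp⟩
  · rintro ⟨b, hb, c, rfl⟩
    refine ⟨b + c, ?_, by ext; simp⟩
    simpa [monomial_mul, add_comm] using J.mul_mem_left (monomial c (1 : k)) hb.prop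

theorem isClosed_convexHull_latticePoints [Finite σ] (J : Ideal (MvPolynomial σ k)) :
    IsClosed (convexHull ℝ (latticePoints J)) := by
  obtain ⟨F, hF, h⟩ := exists_finite_convexHull_latticePoints J
  rw [h]
  exact isClosed_Ici.add_left_of_isCompact (hF.isCompact_convexHull ℝ)

theorem convexHull_latticePoints_of_le [Finite σ] {J : Ideal (MvPolynomial σ k)} {v w : σ → ℝ}
    (hv : v ∈ convexHull ℝ (latticePoints J)) (hvw : v ≤ w) :
    w ∈ convexHull ℝ (latticePoints J) := by
  obtain ⟨F, -, h⟩ := exists_finite_convexHull_latticePoints J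
  rw [h] at hv ⊢
  obtain ⟨x, hx, y, hy, rfl⟩ := hv
  refine ⟨x, hx, w - x, ?_, by simp⟩
  exact sub_nonneg.2 ((le_add_of_nonneg_right hy).trans hvw)

theorem nonneg_of_mem_convexHull_latticePoints {J : Ideal (MvPolynomial σ k)} {v : σ → ℝ}
    (hv : v ∈ convexHull ℝ (latticePoints J)) : 0 ≤ v := by
  refine convexHull_min ?_ (convex_Ici (0 : σ → ℝ)) hv
  rintro _ ⟨a, -, rfl⟩ i
  exact Nat.cast_nonneg _

/-- A closed nonempty set of nonnegative vectors has a point of least coordinate sum. -/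
theorem isLeast_minCoordinateSum [Fintype σ] {Q : Set (σ → ℝ)} (hQ : IsClosed Q)
    (hne : Q.Nonempty) (hnonneg : ∀ v ∈ Q, 0 ≤ v) :
    IsLeast (coordinateSums Q) (minCoordinateSum Q) := by
  obtain ⟨w, hw⟩ := hne
  have hcont : Continuous fun v : σ → ℝ => ∑ i, v i := by fun_prop
  have hcpt : IsCompact (Q ∩ {v | ∑ i, v i ≤ ∑ i, w i}) := by
    refine (isCompact_Icc (a := (0 : σ → ℝ)) (b := fun _ => ∑ i, w i)).of_isClosed_subset
      (hQ.inter (isClosed_le hcont continuous_const)) ?_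
    rintro v ⟨hv, hvw⟩
    exact ⟨hnonneg v hv, fun i =>
      (Finset.single_le_sum (fun j _ => hnonneg v hv j) (Finset.mem_univ i)).trans hvw⟩
  obtain ⟨u, ⟨huQ, huw⟩, hu⟩ := hcpt.exists_isMinOn ⟨w, hw, by simp⟩ hcont.continuousOn
  have hleast : IsLeast (coordinateSums Q) (∑ i, u i) := by
    refine ⟨⟨u, huQ, rfl⟩, ?_⟩
    rintro _ ⟨v, hv, rfl⟩
    rcases le_total (∑ i, v i) (∑ i, w i) with h | h
    · exact hu ⟨hv, h⟩
    · exact le_trans huw h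
  rw [minCoordinateSum, hleast.csInf_eq]
  exact hleast

/-! ### Symbolic powers and the symbolic polyhedron -/

theorem IsMonomialIdeal.div_mem_convexHull [Finite σ] {I P : Ideal (MvPolynomial σ k)}
    (hI : IsMonomialIdeal I) {hP : P.IsPrime} {m : ℕ} (hm : 0 < m) {a : σ →₀ ℕ}
    (ha : monomial a (1 : k) ∈ localContraction (I ^ m) P hP) :
    (fun i => (a i : ℝ) / m) ∈ convexHull ℝ (latticePoints (localContraction I P hP)) := by
  obtain ⟨c, hc, hle⟩ := hI.exists_sum_le ha
  have hm' : (0 : ℝ) < m := Nat.cast_pos.2 hm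
  have hmean : ∑ j : Fin m, (m : ℝ)⁻¹ • (fun i => (c j i : ℝ)) ∈
      convexHull ℝ (latticePoints (localContraction I P hP)) := by
    refine (convex_convexHull ℝ _).sum_mem (fun _ _ => inv_nonneg.2 hm'.le) ?_
      fun j _ => subset_convexHull ℝ _ ⟨c j, hc j, rfl⟩
    simp [hm'.ne']
  refine convexHull_latticePoints_of_le hmean fun i => ?_
  have hi : ((∑ j, c j i : ℕ) : ℝ) ≤ a i := by
    have := hle i
    rw [Finsupp.finsetSum_apply] at this
    exact_mod_cast this
  rw [Finset.sum_apply]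
  simp only [Pi.smul_apply, smul_eq_mul]
  rw [← Finset.mul_sum, div_eq_inv_mul, ← Nat.cast_sum]
  exact mul_le_mul_of_nonneg_left hi (inv_nonneg.2 hm'.le)

/-- Every lattice point above `m • v`, up to a constant independent of `m`, is the exponent of a
monomial in the contraction of `I ^ m`, provided `v` is in the hull belonging to the contraction
of `I`. -/
theorem exists_forall_monomial_mem_localContraction_pow {I P : Ideal (MvPolynomial σ k)}
    {hP : P.IsPrime} [Finite σ] {v : σ → ℝ}
    (hv : v ∈ convexHull ℝ (latticePoints (localContraction I P hP))) :
    ∃ C : ℝ, ∀ (m : ℕ) (a : σ →₀ ℕ), (∀ i, m * v i + C ≤ a i) →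
      monomial a (1 : k) ∈ localContraction (I ^ m) P hP := by
  have := Fintype.ofFinite σ
  obtain ⟨ι, _, w, z, hw0, hw1, hz, rfl⟩ := mem_convexHull_iff_exists_fintype.1 hv
  choose c hc hcz using hz
  refine ⟨∑ i, ∑ j, (c j i : ℝ), fun m a ha => ?_⟩
  -- Rounding up the weights `m * w j` gives at least `m` factors in total and moves each
  -- coordinate by at most the sum of the vertices.
  set N : ι → ℕ := fun j => ⌈m * w j⌉₊ with hN
  have hsum : m ≤ ∑ j, N j := by
    have h : (m : ℝ) ≤ ∑ j, (N j : ℝ) := by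
      calc (m : ℝ) = ∑ j, m * w j := by rw [← Finset.mul_sum, hw1, mul_one]
        _ ≤ _ := Finset.sum_le_sum fun j _ => Nat.le_ceil _
    exact_mod_cast h
  have hmem : monomial (∑ j, N j • c j) (1 : k) ∈ localContraction (I ^ m) P hP := by
    refine localContraction_pow_le m (Ideal.pow_le_pow_right hsum ?_)
    rw [monomial_sum_one, ← Finset.prod_pow_eq_pow_sum]
    refine Ideal.prod_mem_prod fun j _ => ?_
    simpa [monomial_pow] using Ideal.pow_mem_pow (hc j) (N j)
  refine monomial_mem_of_le (fun i => ?_) hmem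
  have hi : ∑ j, (N j : ℝ) * c j i ≤ a i := by
    refine le_trans ?_ (ha i)
    calc ∑ j, (N j : ℝ) * c j i ≤ ∑ j, (m * w j + 1) * c j i :=
          Finset.sum_le_sum fun j _ => mul_le_mul_of_nonneg_right
            (Nat.ceil_lt_add_one (mul_nonneg m.cast_nonneg (hw0 j))).le (Nat.cast_nonneg _)
      _ = m * (∑ j, w j • z j) i + ∑ j, (c j i : ℝ) := by
          simp only [Finset.sum_apply, Pi.smul_apply, smul_eq_mul, hcz, Finset.mul_sum,
            ← Finset.sum_add_distrib]
          exact Finset.sum_congr rfl fun j _ => by ring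
      _ ≤ _ := by
          gcongr
          exact Finset.single_le_sum (f := fun i => ∑ j, (c j i : ℝ))
            (fun _ _ => Finset.sum_nonneg fun _ _ => Nat.cast_nonneg _) (Finset.mem_univ i)
  rw [Finsupp.finsetSum_apply]
  simp only [Finsupp.smul_apply, smul_eq_mul]
  exact_mod_cast hi

variable {I : Ideal (MvPolynomial σ k)}

theorem initialDegree_le {J : Ideal (MvPolynomial σ k)} {a : σ →₀ ℕ}
    (ha : monomial a (1 : k) ∈ J) : initialDegree J ≤ a.degree :=
  Nat.sInf_le ⟨_, ha, by simp, isHomogeneous_monomial _ rfl⟩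

theorem mem_symbolicPolyhedron {v : σ → ℝ} :
    v ∈ symbolicPolyhedron I ↔ ∀ (P : Ideal (MvPolynomial σ k)) (hP : P ∈ maxAss I),
      v ∈ convexHull ℝ
        (latticePoints (localContraction I P (isPrime_of_mem_maxAss hP))) := by
  simp [symbolicPolyhedron]

theorem IsMonomialIdeal.symbolicPolyhedron_nonempty (hI : IsMonomialIdeal I) (hI0 : I ≠ ⊥) :
    (symbolicPolyhedron I).Nonempty := by
  obtain ⟨f, hf, hf0⟩ := Submodule.exists_mem_ne_zero_of_ne_bot hI0
  obtain ⟨a, ha⟩ := support_nonempty.2 hf0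
  exact ⟨_, mem_symbolicPolyhedron.2 fun P hP => subset_convexHull ℝ _
    ⟨a, le_localContraction (hI.monomial_mem hf ha), rfl⟩⟩

variable [Fintype σ]

theorem isClosed_symbolicPolyhedron : IsClosed (symbolicPolyhedron I) :=
  isClosed_iInter fun _ => isClosed_iInter fun _ => isClosed_convexHull_latticePoints _

theorem symbolicPolyhedron_nonneg (hI1 : I ≠ ⊤) {v : σ → ℝ} (hv : v ∈ symbolicPolyhedron I) :
    0 ≤ v := by
  obtain ⟨P, hP⟩ := maxAss_nonempty hI1
  exact nonneg_of_mem_convexHull_latticePoints (mem_symbolicPolyhedron.1 hv P hP)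

/-- Upper bound for initial degrees: the multiples of a point of the symbolic polyhedron can be
rounded to exponents of monomials in the symbolic powers, at a bounded cost in degree. The
constants of the maximal associated primes have a common bound since these primes are finite in
number. -/
theorem exists_forall_exists_monomial_mem_symbolicPower (hI1 : I ≠ ⊤) {v : σ → ℝ}
    (hv : v ∈ symbolicPolyhedron I) :
    ∃ C : ℝ, ∀ m : ℕ, ∃ a : σ →₀ ℕ, monomial a (1 : k) ∈ symbolicPower I m ∧
      (a.degree : ℝ) ≤ m * ∑ i, v i + C := by
  have hv0 := symbolicPolyhedron_nonneg hI1 hv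
  choose! C hC using fun (P : Ideal (MvPolynomial σ k)) (hP : P ∈ maxAss I) =>
    exists_forall_monomial_mem_localContraction_pow (mem_symbolicPolyhedron.1 hv P hP)
  obtain ⟨B, hB⟩ := ((finite_maxAss I).image C).bddAbove
  refine ⟨∑ _i : σ, (max B 0 + 1), fun m => ?_⟩
  refine ⟨Finsupp.equivFunOnFinite.symm fun i => ⌈m * v i + max B 0⌉₊,
    mem_symbolicPower_iff_maxAss.2 fun P hP => hC P hP m _ fun i => ?_, ?_⟩
  · have : C P ≤ max B 0 := (hB ⟨P, hP, rfl⟩).trans (le_max_left _ _)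
    exact le_trans (by gcongr) (Nat.le_ceil _)
  · rw [Finsupp.degree_eq_sum, Nat.cast_sum, Finset.mul_sum, ← Finset.sum_add_distrib]
    refine Finset.sum_le_sum fun i _ => ?_
    rw [← add_assoc]
    exact (Nat.ceil_lt_add_one
      (add_nonneg (mul_nonneg m.cast_nonneg (hv0 i)) (le_max_right _ _))).le

/-- Lower bound for initial degrees: take an exponent of a form of least degree in the symbolic
power and divide it by `m`. The hypothesis `hne` ensures that there is such a form. -/
theorem IsMonomialIdeal.exists_mem_symbolicPolyhedron (hI : IsMonomialIdeal I) {m : ℕ}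
    (hm : 0 < m) (hne : symbolicPower I m ≠ ⊥) :
    ∃ v ∈ symbolicPolyhedron I, ∑ i, v i = (initialDegree (symbolicPower I m) : ℝ) / m := by
  have hset : {d : ℕ | ∃ f ∈ symbolicPower I m, f ≠ 0 ∧ f.IsHomogeneous d}.Nonempty := by
    obtain ⟨f, hf, hf0⟩ := Submodule.exists_mem_ne_zero_of_ne_bot hne
    obtain ⟨a, ha⟩ := support_nonempty.2 hf0
    refine ⟨a.degree, monomial a (1 : k), mem_symbolicPower_iff_maxAss.2 fun P hP =>
      (hI.pow m).localContraction_monomial_mem (mem_symbolicPower_iff_maxAss.1 hf P hP) ha,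
      by simp, isHomogeneous_monomial _ rfl⟩
  obtain ⟨f, hf, hf0, hfd⟩ := Nat.sInf_mem hset
  obtain ⟨a, ha⟩ := support_nonempty.2 hf0
  refine ⟨fun i => (a i : ℝ) / m, mem_symbolicPolyhedron.2 fun P hP =>
    hI.div_mem_convexHull hm ((hI.pow m).localContraction_monomial_mem
      (mem_symbolicPower_iff_maxAss.1 hf P hP) ha), ?_⟩
  have hdeg : a.degree = initialDegree (symbolicPower I m) := by
    rw [Finsupp.degree_eq_weight_one]
    exact hfd (mem_support_iff.1 ha)
  rw [← Finset.sum_div, ← hdeg, Finsupp.degree_eq_sum, Nat.cast_sum]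

theorem IsMonomialIdeal.tendsto_initialDegree_div (hI : IsMonomialIdeal I) (hI0 : I ≠ ⊥)
    (hI1 : I ≠ ⊤) :
    Tendsto (fun m : ℕ => (initialDegree (symbolicPower I m) : ℝ) / (m : ℝ)) atTop
      (𝓝 (minCoordinateSum (symbolicPolyhedron I))) := by
  have hleast := isLeast_minCoordinateSum isClosed_symbolicPolyhedron
    (hI.symbolicPolyhedron_nonempty hI0) fun v hv => symbolicPolyhedron_nonneg hI1 hv
  obtain ⟨⟨v, hv, hvsum⟩, hlower⟩ := hleast
  obtain ⟨C, hC⟩ := exists_forall_exists_monomial_mem_symbolicPower hI1 hv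
  have hlim : Tendsto (fun m : ℕ => minCoordinateSum (symbolicPolyhedron I) + C / (m : ℝ)) atTop
      (𝓝 (minCoordinateSum (symbolicPolyhedron I))) := by
    simpa using tendsto_const_nhds.add (tendsto_const_div_atTop_nhds_zero_nat C)
  refine tendsto_of_tendsto_of_tendsto_of_le_of_le' tendsto_const_nhds hlim ?_ ?_
  · filter_upwards [eventually_gt_atTop 0] with m hm
    obtain ⟨a, ha, -⟩ := hC m
    have hne : symbolicPower I m ≠ ⊥ := by
      intro h
      rw [h, Ideal.mem_bot, monomial_eq_zero] at ha
      exact one_ne_zero ha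
    obtain ⟨w, hw, hwsum⟩ := hI.exists_mem_symbolicPolyhedron hm hne
    exact hwsum ▸ hlower ⟨w, hw, rfl⟩
  · filter_upwards [eventually_gt_atTop 0] with m hm
    obtain ⟨a, ha, hdeg⟩ := hC m
    have hm' : (0 : ℝ) < m := Nat.cast_pos.2 hm
    rw [div_le_iff₀ hm', add_mul, div_mul_cancel₀ _ hm'.ne', ← hvsum, mul_comm]
    exact (Nat.cast_le.2 (initialDegree_le ha)).trans hdeg

end SymbolicPolyhedron

/-- For a nonzero proper monomial ideal `I`, the minimum `α(Q)` of the coordinate sum over the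
symbolic polyhedron `Q` of `I` is attained, the limit defining `γ(I)` exists, and
`α(Q) = γ(I)`. -/
theorem mainTheorem5 {k : Type*} [Field k] (n : ℕ)
    (I : Ideal (MvPolynomial (Fin (n + 1)) k))
    (hI : SymbolicPolyhedron.IsMonomialIdeal I) (hI0 : I ≠ ⊥) (hI1 : I ≠ ⊤) :
    IsLeast
        (SymbolicPolyhedron.coordinateSums (SymbolicPolyhedron.symbolicPolyhedron I))
        (SymbolicPolyhedron.minCoordinateSum (SymbolicPolyhedron.symbolicPolyhedron I)) ∧
      Tendsto
        (fun m : ℕ =>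
          (SymbolicPolyhedron.initialDegree (SymbolicPolyhedron.symbolicPower I m) : ℝ) / (m : ℝ))
        atTop (𝓝 (SymbolicPolyhedron.waldschmidtConstant I)) ∧
      SymbolicPolyhedron.minCoordinateSum (SymbolicPolyhedron.symbolicPolyhedron I) =
        SymbolicPolyhedron.waldschmidtConstant I := by
  have hlim := hI.tendsto_initialDegree_div hI0 hI1
  have heq : SymbolicPolyhedron.waldschmidtConstant I =
      SymbolicPolyhedron.minCoordinateSum (SymbolicPolyhedron.symbolicPolyhedron I) :=
    hlim.limUnder_eq
  exact ⟨SymbolicPolyhedron.isLeast_minCoordinateSum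
      SymbolicPolyhedron.isClosed_symbolicPolyhedron (hI.symbolicPolyhedron_nonempty hI0)
      fun v hv => SymbolicPolyhedron.symbolicPolyhedron_nonneg hI1 hv,
    heq ▸ hlim, heq.symm⟩
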